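/- For $x,y\in\{0,1\}^m$ let $h(x,y)$ be the Hamming distance. In the congested clique with $n$ nodes, computation proceeds in synchronous rounds; in each round every node may send to each other node its own message of $O(\log n)$ bits (here $\lceil\log_2 n\rceil$ bits), and local computation is unlimited. Let node $i\in\{1,\dots,n\}$ hold a point $p_i\in\{0,1\}^n$. The protocol HMST with parameters $k\in\mathbb N$ and $\delta:\mathbb N\to[0,1]$ works as follows. 1. For every scale $r\in\{1,2,4,\dots,2^{\lceil\log_2 n\rceil}\}$ the first node generates, from its private random bits, a random $k\times n$ matrix $A_r$ over $GF(2)$; all entries of all matrices are independent, and each entry of $A_r$ is $1$ with probability $\delta(r)$. It sends the matrices to all nodes. 2. Each node $i$ computes $A_rp_i$ (over $GF(2)$) for all scales $r$ and sends the results to the first node. 3. For each pair $i\ne j$ the first node sets $w_{ij}$ to be the smallest scale $r$ with $h(A_rp_i,A_rp_j)\le k/4$ (and $w_{ij}=2^{\lceil\log_2 n\rceil}$ if there is no such scale). It outputs a minimum spanning tree $T$ of the complete graph on $\{1,\dots,n\}$ with edge weights $w_{ij}$, computed locally, with ties broken in any fixed way. **Theorem.** There is a function $\delta:\mathbb N\to[0,1]$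 such that for every $c>0$ and every sufficiently large integer $K$ (depending on $c$) there is a constant $C$ such that for all $n\ge 2$, the protocol HMST with parameters $k=K\lceil\log_2 n\rceil$ and $\delta$ has the following properties. * It can be implemented on the congested clique with $n$ nodes in at most $C\log_2^3 n$ rounds (for all inputs and all outcomes of the random bits). * Its output $T$ is always a spanning tree on $\{1,\dots,n\}$. * For all points $p_1,\dots,p_n\in\{0,1\}^n$, with probability at least $1-n^{-c}$, $$\sum_{(i,j)\in T}h(p_i,p_j)\;\le\; 3\sum_{(i,j)\in U}h(p_i,p_j)+3n-3,$$ where $U$ is a minimum spanning tree of the points in the Hamming metric. -/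

import Mathlib

/-! ### The congested clique -/

/-- A deterministic message-passing algorithm on the congested clique with `n` nodes.
Every node starts from its own local data in `D` (its input and, if it has any, its private random
bits). In each round every node sends to every node a message of `b` bits (messages to different
nodes may differ), which depends only on the sender and its current state; a node then updates its
state from the messages it received. Local computation is unrestricted. -/
structure CliqueAlgorithm (n b : ℕ) (D : Type) where
  State : Type
  init : Fin n → D → State
  send : Fin n → State → Fin n → (Fin b → Bool)
  receive : Fin n → State → (Fin n → (Fin b → Bool)) → State

/-- The state of node `i` after `t` rounds, when node `j` starts with the local data `d j`. -/
def CliqueAlgorithm.run {n b : ℕ} {D : Type} (M : CliqueAlgorithm n b D) (d : Fin n → D) :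
    ℕ → Fin n → M.State
  | 0, i => M.init i (d i)
  | t + 1, i => M.receive i (M.run d t i) (fun j => M.send j (M.run d t j) i)

/-- After `t` rounds, node `i` can compute the value `g x` locally, for every global input `x`.
The global input `x` is distributed among the nodes by `data x`. -/
def CliqueAlgorithm.Holds {n b : ℕ} {D X α : Type} (M : CliqueAlgorithm n b D)
    (data : X → Fin n → D) (t : ℕ) (i : Fin n) (g : X → α) : Prop :=
  ∃ out : M.State → α, ∀ x, out (M.run (data x) t i) = g x

/-! ### Minimum spanning trees -/

open Classical in
/-- The cost of the graph `T` on `Fin n` for symmetric edge weights `w`. -/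
noncomputable def treeCost {n : ℕ} (w : Fin n → Fin n → ℕ) (T : SimpleGraph (Fin n)) : ℕ :=
  ∑ i : Fin n, ∑ j : Fin n, if i < j ∧ T.Adj i j then w i j else 0

/-- `T` is a minimum spanning tree of the complete graph on `Fin n` with edge weights `w`. -/
def IsMST {n : ℕ} (w : Fin n → Fin n → ℕ) (T : SimpleGraph (Fin n)) : Prop :=
  T.IsTree ∧ ∀ U : SimpleGraph (Fin n), U.IsTree → treeCost w T ≤ treeCost w U

/-- `mst` is a correct (local) MST procedure: for all symmetric weights it returns a minimum
spanning tree. Ties may be broken in any way. -/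
def IsMSTProcedure {n : ℕ} (mst : (Fin n → Fin n → ℕ) → SimpleGraph (Fin n)) : Prop :=
  ∀ w : Fin n → Fin n → ℕ, (∀ i j, w i j = w j i) → IsMST w (mst w)

/-! ### The protocol HMST -/

/-- A family of `n` points of `{0,1}^n`; point `p i` is the input of node `i`. -/
abbrev Points (n : ℕ) : Type := Fin n → Fin n → ZMod 2

/-- Pairwise Hamming distances of the points. -/
def hamming {n : ℕ} (p : Points n) (i j : Fin n) : ℕ := hammingDist (p i) (p j)

/-- The random bits of the protocol: one `k × n` array for each scale
`2 ^ s`, `s = 0, …, ⌈log₂ n⌉`. -/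
abbrev Coins (n k : ℕ) : Type := Fin (Nat.clog 2 n + 1) → Fin k → Fin n → Bool

/-- All bits are independent; those for scale `r = 2 ^ s` are `true` with probability `δ r`. -/
noncomputable def coinMeasure (δ : ℕ → unitInterval) (n k : ℕ) :
    MeasureTheory.Measure (Coins n k) :=
  MeasureTheory.Measure.pi fun s => MeasureTheory.Measure.pi fun _ =>
    MeasureTheory.Measure.pi fun _ =>
      ProbabilityTheory.bernoulliMeasure true false (δ (2 ^ (s : ℕ)))

/-- The random `k × n` matrix over GF(2) for scale `2 ^ s`. -/
def projMatrix {n k : ℕ} (ω : Coins n k) (s : Fin (Nat.clog 2 n + 1)) :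
    Matrix (Fin k) (Fin n) (ZMod 2) :=
  Matrix.of fun a j => if ω s a j then 1 else 0

/-- The projection of point `p i` for scale `2 ^ s`. -/
def projection {n k : ℕ} (p : Points n) (ω : Coins n k) (i : Fin n)
    (s : Fin (Nat.clog 2 n + 1)) : Fin k → ZMod 2 :=
  (projMatrix ω s).mulVec (p i)

/-- The estimate of the Hamming distance of points `i` and `j`: the smallest scale `r = 2 ^ s` at
which the projections differ in at most `k / 4` coordinates (the largest scale if there is
none). -/
noncomputable def estimate {n k : ℕ} (p : Points n) (ω : Coins n k) (i j : Fin n) : ℕ :=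
  sInf (insert (2 ^ Nat.clog 2 n)
    {r : ℕ | ∃ s : Fin (Nat.clog 2 n + 1), r = 2 ^ (s : ℕ) ∧
      4 * hammingDist (projection p ω i s) (projection p ω j s) ≤ k})

/-- The output of HMST: a minimum spanning tree for the estimated distances. -/
noncomputable def hmstTree {n k : ℕ} (mst : (Fin n → Fin n → ℕ) → SimpleGraph (Fin n))
    (p : Points n) (ω : Coins n k) : SimpleGraph (Fin n) :=
  mst (estimate p ω)

/-- Initial local data: node `i` holds its point; only the first node holds the random bits. -/
def hmstData {n k : ℕ} (x : Points n × Coins n k) (i : Fin n) :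
    (Fin n → ZMod 2) × Option (Coins n k) :=
  (x.1 i, if i.val = 0 then some x.2 else none)

/-- The algorithm `M` carries out HMST in `t` rounds on all inputs and for all outcomes of the
random bits: first all nodes learn the random matrices, then the first node learns the projections
of all points, and at the end the first node holds the output tree. -/
def ImplementsHMST {n b k : ℕ} (M : CliqueAlgorithm n b ((Fin n → ZMod 2) × Option (Coins n k)))
    (mst : (Fin n → Fin n → ℕ) → SimpleGraph (Fin n)) (t : ℕ) : Prop :=
  ∃ t₁ t₂ : ℕ, t₁ ≤ t₂ ∧ t₂ ≤ t ∧
    (∀ i : Fin n, M.Holds hmstData t₁ i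
      (fun x : Points n × Coins n k => projMatrix x.2)) ∧
    (∀ i : Fin n, i.val = 0 → M.Holds hmstData t₂ i
      (fun x : Points n × Coins n k => projection x.1 x.2)) ∧
    (∀ i : Fin n, i.val = 0 → M.Holds hmstData t i
      (fun x : Points n × Coins n k => hmstTree mst x.1 x.2))

/-!
Let `q = flipProb r = (1 - (3/5)^(1/r)) / 2` be the density of the random matrix for scale `r`. For
two points at distance `h`, a bit of the projection of their difference is a parity of `h`
independent bits, and its sign has mean `(1 - 2q)^h = (3/5)^(h/r)` (`integral_parity_rowDot`). This
is at least `3/5` for `h ≤ r` and at most `(3/5)^(3/2) < 19/40` for `h ≥ 3r/2`, while the test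
"at most `k/4` differing bits" says that the `k` signs have average at least `1/2`. By Hoeffding's
inequality the test is wrong outside the gap `r < h < 3r/2` with probability at most
`exp (-k/3200)` (`coinMeasure_not_wellSeparated_le`), and for `k = K ⌈log₂ n⌉` with
`K ≥ 3200 (4 + c)` a union bound over all pairs and scales leaves a failure probability of at most
`n^(-c)` (`union_bound_le`).

If all tests are right, the estimates satisfy `2h ≤ 3w` (`two_mul_hamming_le`) and `w ≤ 2h + 1`
(`estimate_le`). Since a spanning tree has `n - 1` edges, the tree `T` that is optimal for `w` and
any other tree `U` satisfy `2 h(T) ≤ 3 w(T) ≤ 3 w(U) ≤ 6 h(U) + 3 (n - 1)`, which is stronger than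
required (`treeCost_hmstTree_le`).

For the round complexity, the first node scatters the columns of the matrices over the nodes, which
then broadcast them; each phase, like the collection of the projections at the end, sends
`(⌈log₂ n⌉ + 1) K` messages of `⌈log₂ n⌉` bits over every link (`exists_implementsHMST`). In fact
`O(log n)` rounds suffice.
-/

/-! ### Hoeffding's inequality for product measures -/

open MeasureTheory ProbabilityTheory in
/-- Hoeffding's inequality for `k` independent copies of a `[-1, 1]`-valued variable. -/
lemma measureReal_pi_sum_sub_ge_le {Ω : Type*} [MeasurableSpace Ω] (μ : Measure Ω)
    [IsProbabilityMeasure μ] {f : Ω → ℝ} (hf : Measurable f) (hb : ∀ x, f x ∈ Set.Icc (-1) 1)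
    (k : ℕ) {ε : ℝ} (hε : 0 ≤ ε) :
    (Measure.pi fun _ : Fin k => μ).real {ω | k * ε ≤ ∑ a, (f (ω a) - ∫ x, f x ∂μ)} ≤
      Real.exp (-(k * ε ^ 2 / 2)) := by
  have hmean : ∀ a : Fin k, ∫ ω, f (ω a) ∂(Measure.pi fun _ : Fin k => μ) = ∫ x, f x ∂μ :=
    fun a => integral_comp_eval (μ := fun _ : Fin k => μ) hf.aestronglyMeasurable
  have hsub : ∀ a ∈ (Finset.univ : Finset (Fin k)),
      HasSubgaussianMGF (fun ω : Fin k → Ω => f (ω a) - ∫ x, f x ∂μ) 1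
        (Measure.pi fun _ : Fin k => μ) := by
    intro a _
    have := hasSubgaussianMGF_of_mem_Icc (μ := Measure.pi fun _ : Fin k => μ)
      (X := fun ω => f (ω a)) (hf.comp (measurable_pi_apply a)).aemeasurable
      (Filter.Eventually.of_forall fun ω => hb (ω a))
    rw [hmean] at this
    convert this using 1
    ext
    norm_num
  have h := HasSubgaussianMGF.measure_sum_ge_le_of_iIndepFun
    (iIndepFun_pi (μ := fun _ : Fin k => μ) (X := fun _ x => f x - ∫ x, f x ∂μ)
      (fun _ => (hf.sub_const _).aemeasurable)) hsub (mul_nonneg k.cast_nonneg hε)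
  refine h.trans (Real.exp_le_exp.2 (le_of_eq ?_))
  rcases Nat.eq_zero_or_pos k with rfl | hk
  · simp
  · have : (k : ℝ) ≠ 0 := by positivity
    simp
    field_simp

/-! ### The bias of random parities -/

/-- The nontrivial sign character of `ZMod 2`. -/
noncomputable def parity (x : ZMod 2) : ℝ := if x = 0 then 1 else -1

lemma parity_zero : parity 0 = 1 := by simp [parity]

lemma parity_add (x y : ZMod 2) : parity (x + y) = parity x * parity y := by
  have h : ∀ x y : ZMod 2, x + y = 0 ↔ (x = 0 ↔ y = 0) := by decide
  by_cases hx : x = 0 <;> by_cases hy : y = 0 <;> simp [parity, h, hx, hy]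

lemma parity_sum {ι : Type*} (s : Finset ι) (f : ι → ZMod 2) :
    parity (∑ j ∈ s, f j) = ∏ j ∈ s, parity (f j) := by
  classical
  induction s using Finset.induction_on with
  | empty => simp [parity_zero]
  | insert a s ha ih => rw [Finset.sum_insert ha, Finset.prod_insert ha, parity_add, ih]

lemma parity_mem_Icc (x : ZMod 2) : parity x ∈ Set.Icc (-1 : ℝ) 1 := by
  unfold parity; split_ifs <;> norm_num

lemma sum_parity_sub {k : ℕ} (x y : Fin k → ZMod 2) :
    ∑ a, parity (x a - y a) = k - 2 * (hammingDist x y : ℝ) := by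
  have h : ∀ a, parity (x a - y a) = 1 - 2 * (if x a ≠ y a then 1 else 0) := by
    intro a
    by_cases h : x a = y a
    · simp [h, parity]
    · simp [h, parity, sub_eq_zero]; norm_num
  simp_rw [h]
  rw [Finset.sum_sub_distrib, ← Finset.mul_sum, hammingDist, Finset.sum_boole]
  simp

/-- The inner product over GF(2) of a row of random bits with the vector `d`. -/
def rowDot {n : ℕ} (d : Fin n → ZMod 2) (v : Fin n → Bool) : ZMod 2 :=
  ∑ j, (if v j then 1 else 0) * d j

open MeasureTheory ProbabilityTheory in
/-- The bias of a random parity: each of the positions where `d` is nonzero contributes an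
independent factor `1 - 2q`. -/
lemma integral_parity_rowDot {n : ℕ} (q : unitInterval) (d : Fin n → ZMod 2) :
    ∫ v, parity (rowDot d v) ∂(Measure.pi fun _ : Fin n => bernoulliMeasure true false q) =
      (1 - 2 * (q : ℝ)) ^ hammingNorm d := by
  simp_rw [rowDot, parity_sum]
  rw [integral_fintype_prod_eq_prod
    (f := fun j (b : Bool) => parity ((if b then 1 else 0) * d j))]
  have h : ∀ j, ∫ b, parity ((if b then 1 else 0) * d j) ∂(bernoulliMeasure true false q) =
      if d j ≠ 0 then 1 - 2 * (q : ℝ) else 1 := by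
    intro j
    rw [integral_bernoulliMeasure]
    by_cases h : d j = 0
    · simp [h, parity]
    · simp [h, parity]; ring
  simp_rw [h]
  rw [Finset.prod_ite]
  simp [hammingNorm]

/-- The probability of a one in the random matrix for scale `r`, chosen such that the parity
of `r` positions has bias `3 / 5`. (For `r = 0` it is `0`.) -/
noncomputable def flipProb (r : ℕ) : unitInterval :=
  ⟨(1 - (3 / 5 : ℝ) ^ (1 / r : ℝ)) / 2, by
    have h0 : 0 ≤ (3 / 5 : ℝ) ^ (1 / r : ℝ) := by positivity
    have h1 : (3 / 5 : ℝ) ^ (1 / r : ℝ) ≤ 1 :=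
      Real.rpow_le_one (by norm_num) (by norm_num) (by positivity)
    constructor <;> linarith⟩

lemma one_sub_two_mul_flipProb_pow (r h : ℕ) :
    (1 - 2 * (flipProb r : ℝ)) ^ h = (3 / 5 : ℝ) ^ ((h : ℝ) / r) := by
  have : 1 - 2 * (flipProb r : ℝ) = (3 / 5 : ℝ) ^ (1 / r : ℝ) := by simp [flipProb]; ring
  rw [this, ← Real.rpow_natCast, ← Real.rpow_mul (by norm_num)]
  congr 1
  ring

lemma bias_ge_of_le {r h : ℕ} (hr : 0 < r) (hh : h ≤ r) :
    3 / 5 ≤ (1 - 2 * (flipProb r : ℝ)) ^ h := by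
  have hr' : (0 : ℝ) < r := by exact_mod_cast hr
  rw [one_sub_two_mul_flipProb_pow]
  calc (3 / 5 : ℝ) = (3 / 5) ^ (1 : ℝ) := by simp
    _ ≤ _ := Real.rpow_le_rpow_of_exponent_ge (by norm_num) (by norm_num)
      ((div_le_one hr').2 (by exact_mod_cast hh))

lemma bias_le_of_ge {r h : ℕ} (hr : 0 < r) (hh : 3 * r ≤ 2 * h) :
    (1 - 2 * (flipProb r : ℝ)) ^ h ≤ 19 / 40 := by
  have hr' : (0 : ℝ) < r := by exact_mod_cast hr
  have hh' : (3 : ℝ) * r ≤ 2 * h := by exact_mod_cast hh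
  rw [one_sub_two_mul_flipProb_pow]
  calc _ ≤ (3 / 5 : ℝ) ^ (3 / 2 : ℝ) := Real.rpow_le_rpow_of_exponent_ge (by norm_num) (by norm_num)
        ((le_div_iff₀ hr').2 (by linarith))
    _ ≤ 19 / 40 := by
      refine le_of_abs_le (abs_le_of_sq_le_sq ?_ (by norm_num))
      rw [← Real.rpow_natCast, ← Real.rpow_mul (by norm_num)]
      norm_num

/-! ### Correctness of the threshold tests with high probability -/

/-- The projections of `p i` and `p j` at scale `2 ^ s` classify the distance of the points
correctly, up to the factor `3 / 2`, whenever it is not in the gap between `2 ^ s` and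
`3 / 2 * 2 ^ s`. -/
def WellSeparated {n k : ℕ} (p : Points n) (ω : Coins n k) (i j : Fin n)
    (s : Fin (Nat.clog 2 n + 1)) : Prop :=
  (hamming p i j ≤ 2 ^ (s : ℕ) →
    4 * hammingDist (projection p ω i s) (projection p ω j s) ≤ k) ∧
  (3 * 2 ^ (s : ℕ) ≤ 2 * hamming p i j →
    k < 4 * hammingDist (projection p ω i s) (projection p ω j s))

lemma projection_sub {n k : ℕ} (p : Points n) (ω : Coins n k) (i j : Fin n)
    (s : Fin (Nat.clog 2 n + 1)) (a : Fin k) :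
    projection p ω i s a - projection p ω j s a = rowDot (p i - p j) (ω s a) := by
  rw [projection, projection, ← Pi.sub_apply, ← Matrix.mulVec_sub]
  simp [Matrix.mulVec, dotProduct, projMatrix, rowDot]

open MeasureTheory ProbabilityTheory in
instance {n k : ℕ} (δ : ℕ → unitInterval) : IsProbabilityMeasure (coinMeasure δ n k) := by
  unfold coinMeasure; infer_instance

open MeasureTheory ProbabilityTheory in
/-- A test for one pair at one scale fails with exponentially small probability. The constant
`1 / 40` is the distance of `19 / 40` from the threshold `1 / 2` for the average sign; on the other
side `3 / 5` leaves more room. -/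
lemma coinMeasure_not_wellSeparated_le {n k : ℕ} (p : Points n) (i j : Fin n)
    (s : Fin (Nat.clog 2 n + 1)) :
    (coinMeasure flipProb n k).real {ω | ¬ WellSeparated p ω i j s} ≤
      Real.exp (-(k * (1 / 40) ^ 2 / 2)) := by
  set ν := Measure.pi fun _ : Fin n => bernoulliMeasure true false (flipProb (2 ^ (s : ℕ)))
    with hν
  set f : (Fin n → Bool) → ℝ := fun v => parity (rowDot (p i - p j) v) with hf
  have hmean : ∫ v, f v ∂ν = (1 - 2 * (flipProb (2 ^ (s : ℕ)) : ℝ)) ^ hamming p i j := by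
    rw [hν, integral_parity_rowDot, hamming, hammingDist_comm, hammingDist_eq_hammingNorm,
      neg_add_eq_sub]
  have hr : 0 < 2 ^ (s : ℕ) := by positivity
  have hsum : ∀ ω : Coins n k, ∑ a, f (ω s a) =
      k - 2 * (hammingDist (projection p ω i s) (projection p ω j s) : ℝ) := by
    intro ω
    rw [← sum_parity_sub]
    simp_rw [projection_sub, hf]
  -- Pull events that depend only on the matrix for scale `2 ^ s` back from its marginal.
  have hmap : ∀ A : Set (Fin k → Fin n → Bool),
      (coinMeasure flipProb n k).real {ω | ω s ∈ A} = (Measure.pi fun _ : Fin k => ν).real A := by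
    intro A
    have := measurePreserving_eval (fun s : Fin (Nat.clog 2 n + 1) =>
      Measure.pi fun _ : Fin k => Measure.pi fun _ : Fin n =>
        bernoulliMeasure true false (flipProb (2 ^ (s : ℕ)))) s
    exact this.measureReal_preimage (Set.toFinite A).measurableSet.nullMeasurableSet
  have hmeas : Measurable f := measurable_of_finite f
  have hle : ∀ ω : Coins n k, ∀ b : ℝ, ∑ a, (f (ω s a) - b) = ∑ a, f (ω s a) - k * b := by
    intro ω b; simp [Finset.sum_sub_distrib]
  by_cases hc : hamming p i j ≤ 2 ^ (s : ℕ)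
  · have hge := bias_ge_of_le hr hc
    rw [← hmean] at hge
    -- Here the lower tail matters, hence `-f`.
    refine le_trans (le_of_le_of_eq (measureReal_mono ?_) (hmap _))
      (measureReal_pi_sum_sub_ge_le ν (f := fun v => - f v) hmeas.neg
        (fun v => ?_) k (ε := 1 / 40) (by norm_num))
    · intro ω hω
      have h4 : k < 4 * hammingDist (projection p ω i s) (projection p ω j s) := by
        by_contra h
        exact hω ⟨fun _ => not_lt.1 h, fun h' => absurd h' (by omega)⟩
      have h4' : (k : ℝ) < 4 * (hammingDist (projection p ω i s) (projection p ω j s) : ℝ) := by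
        exact_mod_cast h4
      have : ∑ a, (- f (ω s a) - ∫ v, - f v ∂ν) = k * ∫ v, f v ∂ν - ∑ a, f (ω s a) := by
        simp [integral_neg, Finset.sum_add_distrib]; ring
      simp only [Set.mem_ofPred_eq]
      rw [this, hsum]
      have := mul_le_mul_of_nonneg_left hge (Nat.cast_nonneg (α := ℝ) k)
      linarith [Nat.cast_nonneg (α := ℝ) k]
    · have := parity_mem_Icc (rowDot (p i - p j) v)
      constructor <;> simp only [hf] <;> linarith [this.1, this.2]
  · by_cases hc' : 3 * 2 ^ (s : ℕ) ≤ 2 * hamming p i j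
    · have hge := bias_le_of_ge hr hc'
      rw [← hmean] at hge
      refine le_trans (le_of_le_of_eq (measureReal_mono ?_) (hmap _))
        (measureReal_pi_sum_sub_ge_le ν (f := f) hmeas
          (fun v => parity_mem_Icc _) k (ε := 1 / 40) (by norm_num))
      intro ω hω
      have h4 : 4 * hammingDist (projection p ω i s) (projection p ω j s) ≤ k := by
        by_contra h
        exact hω ⟨fun h' => absurd h' hc, fun _ => not_le.1 h⟩
      have h4' : 4 * (hammingDist (projection p ω i s) (projection p ω j s) : ℝ) ≤ k := by
        exact_mod_cast h4
      simp only [Set.mem_ofPred_eq]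
      rw [hle, hsum]
      have := mul_le_mul_of_nonneg_left hge (Nat.cast_nonneg (α := ℝ) k)
      linarith [Nat.cast_nonneg (α := ℝ) k]
    · have : {ω : Coins n k | ¬ WellSeparated p ω i j s} = ∅ := by
        ext ω
        simp [WellSeparated, hc, hc']
      rw [this]
      simp
      positivity

open MeasureTheory in
/-- Union bound over all pairs of points and all scales. -/
lemma coinMeasure_wellSeparated_ge {n k : ℕ} (p : Points n) :
    1 - (n : ℝ) ^ 2 * (Nat.clog 2 n + 1) * Real.exp (-(k * (1 / 40) ^ 2 / 2)) ≤
      (coinMeasure flipProb n k).real {ω | ∀ i j s, WellSeparated p ω i j s} := by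
  set G : Set (Coins n k) := {ω | ∀ i j s, WellSeparated p ω i j s}
  have hG : MeasurableSet G := (Set.toFinite G).measurableSet
  have hcompl : Gᶜ = ⋃ t : Fin n × Fin n × Fin (Nat.clog 2 n + 1),
      {ω | ¬ WellSeparated p ω t.1 t.2.1 t.2.2} := by
    ext ω
    simp [G]
  have hle : (coinMeasure flipProb n k).real Gᶜ ≤
      (n : ℝ) ^ 2 * (Nat.clog 2 n + 1) * Real.exp (-(k * (1 / 40) ^ 2 / 2)) := by
    rw [hcompl]
    refine (measureReal_iUnion_fintype_le _).trans ((Finset.sum_le_sum fun t _ =>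
      coinMeasure_not_wellSeparated_le p t.1 t.2.1 t.2.2).trans (le_of_eq ?_))
    simp
    ring
  rw [probReal_compl_eq_one_sub hG] at hle
  linarith

/-! ### Costs of spanning trees -/

open Classical in
lemma treeCost_le_mul_add {n : ℕ} {v w : Fin n → Fin n → ℕ} {a b : ℕ} {T : SimpleGraph (Fin n)}
    (h : ∀ i j, v i j ≤ a * w i j + b) :
    treeCost v T ≤ a * treeCost w T + b * treeCost (fun _ _ => 1) T := by
  simp only [treeCost, Finset.mul_sum]
  rw [← Finset.sum_add_distrib]
  refine Finset.sum_le_sum fun i _ => ?_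
  rw [← Finset.sum_add_distrib]
  refine Finset.sum_le_sum fun j _ => ?_
  split_ifs
  · simpa using h i j
  · simp

lemma treeCost_mul {n : ℕ} (a : ℕ) (w : Fin n → Fin n → ℕ) (T : SimpleGraph (Fin n)) :
    treeCost (fun i j => a * w i j) T = a * treeCost w T := by
  simp only [treeCost, Finset.mul_sum, mul_ite, mul_zero]

open Classical in
lemma treeCost_one {n : ℕ} {T : SimpleGraph (Fin n)} (hT : T.IsTree) :
    treeCost (fun _ _ => 1) T + 1 = n := by
  have hcard : T.edgeFinset.card + 1 = n := by simpa using hT.card_edgeFinset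
  -- Every edge is counted once as `i < j` and once as `j < i` in the sum of the degrees.
  have hswap : treeCost (fun _ _ => 1) T =
      ∑ i : Fin n, ∑ j : Fin n, if j < i ∧ T.Adj i j then 1 else 0 := by
    rw [treeCost, Finset.sum_comm]
    simp_rw [T.adj_comm]
  have hdeg : treeCost (fun _ _ => 1) T + treeCost (fun _ _ => 1) T = ∑ i, T.degree i := by
    nth_rw 2 [hswap]
    rw [treeCost, ← Finset.sum_add_distrib]
    refine Finset.sum_congr rfl fun i _ => ?_
    rw [← Finset.sum_add_distrib, ← SimpleGraph.card_neighborFinset_eq_degree,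
      SimpleGraph.neighborFinset_eq_filter, Finset.card_filter]
    refine Finset.sum_congr rfl fun j _ => ?_
    by_cases hij : T.Adj i j
    · rcases lt_or_gt_of_ne hij.ne with h | h <;> simp [hij, h, not_lt.2 h.le]
    · simp [hij]
  rw [T.sum_degrees_eq_twice_card_edges] at hdeg
  omega

/-! ### The quality of the estimated distances -/

lemma estimate_comm {n k : ℕ} (p : Points n) (ω : Coins n k) (i j : Fin n) :
    estimate p ω i j = estimate p ω j i := by
  simp only [estimate, hammingDist_comm]

lemma hamming_le {n : ℕ} (p : Points n) (i j : Fin n) : hamming p i j ≤ 2 ^ Nat.clog 2 n := by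
  refine le_trans ?_ (Nat.le_pow_clog (by norm_num) n)
  simpa [hamming] using hammingDist_le_card_fintype (x := p i) (y := p j)

/-- Distances are not underestimated by more than the factor `3 / 2`: an estimate that is too small
would be a scale at which the test accepts a pair that it has to reject. -/
lemma two_mul_hamming_le {n k : ℕ} {p : Points n} {ω : Coins n k} {i j : Fin n}
    (h : ∀ s, WellSeparated p ω i j s) : 2 * hamming p i j ≤ 3 * estimate p ω i j := by
  have hmem := Nat.sInf_mem (Set.insert_nonempty (2 ^ Nat.clog 2 n)
    {r : ℕ | ∃ s : Fin (Nat.clog 2 n + 1), r = 2 ^ (s : ℕ) ∧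
      4 * hammingDist (projection p ω i s) (projection p ω j s) ≤ k})
  change estimate p ω i j ∈ _ at hmem
  rcases hmem with hmax | ⟨s, hs, hpass⟩
  · have := hamming_le p i j
    omega
  · by_contra hlt
    exact absurd hpass (not_le.2 ((h s).2 (by omega)))

/-- Distances are not overestimated by more than the factor `2` (or the additive `1` when the points
coincide): the test accepts at the smallest scale that is at least the distance. -/
lemma estimate_le {n k : ℕ} {p : Points n} {ω : Coins n k} {i j : Fin n}
    (h : ∀ s, WellSeparated p ω i j s) : estimate p ω i j ≤ 2 * hamming p i j + 1 := by
  set d := hamming p i j with hd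
  have hs : Nat.clog 2 d < Nat.clog 2 n + 1 :=
    Nat.lt_succ_of_le ((Nat.clog_le_iff_le_pow (by norm_num)).2 (hamming_le p i j))
  have hle : estimate p ω i j ≤ 2 ^ Nat.clog 2 d := by
    refine Nat.sInf_le (Set.mem_insert_of_mem _ ⟨⟨_, hs⟩, rfl, (h ⟨_, hs⟩).1 ?_⟩)
    exact Nat.le_pow_clog (by norm_num) d
  refine hle.trans ?_
  rcases le_or_gt d 1 with h1 | h1
  · rw [Nat.clog_of_right_le_one h1]; simp
  · have hlt := Nat.pow_pred_clog_lt_self (b := 2) (by norm_num) h1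
    have hpos := Nat.clog_pos (b := 2) (by norm_num) h1
    obtain ⟨m, hm⟩ := Nat.exists_eq_succ_of_ne_zero hpos.ne'
    rw [hm] at hlt ⊢
    simp only [Nat.pred_succ, Nat.succ_eq_add_one, pow_succ] at hlt ⊢
    omega

/-- If the tests are correct for all pairs and scales, the tree for the estimated distances has the
required cost. -/
lemma treeCost_hmstTree_le {n k : ℕ} {mst : (Fin n → Fin n → ℕ) → SimpleGraph (Fin n)}
    (hmst : IsMSTProcedure mst) {p : Points n} {ω : Coins n k}
    (h : ∀ i j s, WellSeparated p ω i j s) {U : SimpleGraph (Fin n)} (hU : U.IsTree) :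
    treeCost (hamming p) (hmstTree mst p ω) ≤ 3 * treeCost (hamming p) U + (3 * n - 3) := by
  have hopt := (hmst (estimate p ω) (estimate_comm p ω)).2 U hU
  have hT : 2 * treeCost (hamming p) (hmstTree mst p ω) ≤
      3 * treeCost (estimate p ω) (hmstTree mst p ω) := by
    rw [← treeCost_mul]
    simpa using treeCost_le_mul_add (b := 0) (T := hmstTree mst p ω)
      fun i j => two_mul_hamming_le (h i j)
  have hE : treeCost (estimate p ω) U ≤
      2 * treeCost (hamming p) U + 1 * treeCost (fun _ _ => 1) U :=
    treeCost_le_mul_add fun i j => estimate_le (h i j)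
  have h1 := treeCost_one hU
  change treeCost _ (hmstTree mst p ω) ≤ _ at hopt
  omega

/-! ### Round complexity -/

/-- The algorithm on the congested clique in which every node records its local data and all
messages that it receives. Its state consists of the number of rounds completed, the local data and
the log of received messages (by round and sender). The messages it sends are given by `msg`. -/
def recordingAlgorithm {n b : ℕ} {D : Type}
    (msg : Fin n → D → ℕ → (ℕ → Fin n → Fin b → Bool) → Fin n → Fin b → Bool) :
    CliqueAlgorithm n b D where
  State := ℕ × D × (ℕ → Fin n → Fin b → Bool)
  init _ d := (0, d, fun _ _ _ => false)
  send i σ := msg i σ.2.1 σ.1 σ.2.2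
  receive _ σ m := (σ.1 + 1, σ.2.1, Function.update σ.2.2 σ.1 m)

/-- To identify a run of `recordingAlgorithm`, it suffices to guess the messages `L i u j` that
node `i` receives from `j` in round `u` and to check that the guess is consistent. -/
lemma recordingAlgorithm_run {n b : ℕ} {D : Type}
    (msg : Fin n → D → ℕ → (ℕ → Fin n → Fin b → Bool) → Fin n → Fin b → Bool)
    (d : Fin n → D) (L : Fin n → ℕ → Fin n → Fin b → Bool)
    (hL : ∀ i j u, msg j (d j) u (fun v => if v < u then L j v else fun _ _ => false) i = L i u j)
    (t : ℕ) (i : Fin n) :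
    (recordingAlgorithm msg).run d t i =
      (t, d i, fun v => if v < t then L i v else fun _ _ => false) := by
  induction t generalizing i with
  | zero => simp [CliqueAlgorithm.run, recordingAlgorithm]
  | succ t ih =>
    rw [CliqueAlgorithm.run]
    simp only [ih]
    simp only [recordingAlgorithm, hL]
    refine Prod.ext rfl (Prod.ext rfl ?_)
    funext v
    rcases lt_trichotomy v t with hv | rfl | hv
    · simp [Function.update_of_ne hv.ne, hv, hv.trans (Nat.lt_succ_self t)]
    · simp
    · simp [Function.update_of_ne hv.ne', not_lt.2 hv.le, not_lt.2 (Nat.succ_le_of_lt hv)]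

/-- A table with `R = (L + 1) * K` entries of `L` bits each, read as a sequence of `R` messages of
`L` bits (`false` beyond the end). -/
def tableMessage {K L : ℕ} (f : Fin (L + 1) → Fin (K * L) → Bool) (u : ℕ) : Fin L → Bool :=
  fun l => if h : u < (L + 1) * K then
    f (finProdFinEquiv.symm ⟨u, h⟩).1 (finProdFinEquiv ((finProdFinEquiv.symm ⟨u, h⟩).2, l))
  else false

/-- The table that is transmitted by a sequence of messages. -/
def tableOfMessages {K L : ℕ} (m : ℕ → Fin L → Bool) (s : Fin (L + 1)) (a : Fin (K * L)) : Bool :=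
  m (finProdFinEquiv (s, (finProdFinEquiv.symm a).1)) (finProdFinEquiv.symm a).2

lemma tableOfMessages_eq {K L : ℕ} (f : Fin (L + 1) → Fin (K * L) → Bool) {m : ℕ → Fin L → Bool}
    (h : ∀ u < (L + 1) * K, m u = tableMessage f u) : tableOfMessages m = f := by
  funext s a
  rw [tableOfMessages, h _ (Fin.is_lt _), tableMessage, dif_pos (Fin.is_lt _)]
  simp only [Fin.eta, Equiv.symm_apply_apply, Prod.mk.eta, Equiv.apply_symm_apply]

section Protocol

variable {n K : ℕ}

/-- The random matrices, assembled from the messages that transmit their columns. -/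
def coinsOfMessages (m : ℕ → Fin n → Fin (Nat.clog 2 n) → Bool) : Coins n (K * Nat.clog 2 n) :=
  fun s a j => tableOfMessages (fun u => m u j) s a

/-- The projections of the point `x` by all matrices, in bits. -/
def projectionBits (x : Fin n → ZMod 2) (ω : Coins n (K * Nat.clog 2 n))
    (s : Fin (Nat.clog 2 n + 1)) (a : Fin (K * Nat.clog 2 n)) : Bool :=
  decide ((projMatrix ω s).mulVec x a = 1)

/-- The messages of HMST, in three phases of `R = (⌈log₂ n⌉ + 1) * K` rounds. In the first phase
the first node sends column `j` of all matrices to node `j`; in the second phase node `j` forwards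
these to all nodes; in the third phase all nodes send their projections to the first node (and, for
simplicity, to all other nodes). `z` is the first node. -/
def hmstMessage (z : Fin n) (d : (Fin n → ZMod 2) × Option (Coins n (K * Nat.clog 2 n)))
    (u : ℕ) (log : ℕ → Fin n → Fin (Nat.clog 2 n) → Bool) (i : Fin n) :
    Fin (Nat.clog 2 n) → Bool :=
  let R := (Nat.clog 2 n + 1) * K
  if u < R then
    d.2.elim (fun _ => false) fun ω => tableMessage (fun s a => ω s a i) u
  else if u < 2 * R then
    log (u - R) z
  else
    tableMessage (projectionBits d.1 (coinsOfMessages (K := K) fun v => log (R + v))) (u - 2 * R)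

/-- The message that node `i` receives from node `j` in round `u` when HMST is run on the global
input `x`. -/
def hmstLog (z : Fin n) (x : Points n × Coins n (K * Nat.clog 2 n)) (i : Fin n) (u : ℕ)
    (j : Fin n) : Fin (Nat.clog 2 n) → Bool :=
  let R := (Nat.clog 2 n + 1) * K
  if u < R then
    if j = z then tableMessage (fun s a => x.2 s a i) u else fun _ => false
  else if u < 2 * R then
    tableMessage (fun s a => x.2 s a j) (u - R)
  else
    tableMessage (projectionBits (x.1 j) x.2) (u - 2 * R)

lemma coinsOfMessages_eq (ω : Coins n (K * Nat.clog 2 n))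
    {m : ℕ → Fin n → Fin (Nat.clog 2 n) → Bool}
    (h : ∀ j, ∀ u < (Nat.clog 2 n + 1) * K, m u j = tableMessage (fun s a => ω s a j) u) :
    coinsOfMessages m = ω := by
  funext s a j
  rw [coinsOfMessages, tableOfMessages_eq (fun s a => ω s a j) (h j)]

lemma hmst_run (z : Fin n) (hz : z.val = 0) (x : Points n × Coins n (K * Nat.clog 2 n))
    (t : ℕ) (i : Fin n) :
    (recordingAlgorithm fun _ d u log i => hmstMessage (K := K) z d u log i).run (hmstData x) t i =
      (t, hmstData x i, fun v => if v < t then hmstLog z x i v else fun _ _ => false) := by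
  refine recordingAlgorithm_run _ _ (hmstLog z x) (fun i j u => ?_) t i
  have hzj : ∀ j : Fin n, j.val = 0 ↔ j = z := fun j => by rw [Fin.ext_iff, hz]
  simp only [hmstMessage, hmstLog]
  split_ifs with h1 h2 h3 h4
  · simp [hmstData, h2, hz]
  · simp [hmstData, hzj, h2]
  · have h5 : u - (Nat.clog 2 n + 1) * K < (Nat.clog 2 n + 1) * K := by omega
    rw [hmstLog, if_pos h5, if_pos rfl]
  · exfalso; omega
  · rw [coinsOfMessages_eq x.2]
    · rfl
    · intro j' v hv
      rw [if_pos (by omega), hmstLog, if_neg (by omega), if_pos (by omega)]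
      simp

/-- HMST runs in `3 (⌈log₂ n⌉ + 1) K` rounds. -/
lemma exists_implementsHMST (hn : 0 < n) (K : ℕ)
    (mst : (Fin n → Fin n → ℕ) → SimpleGraph (Fin n)) :
    ∃ M : CliqueAlgorithm n (Nat.clog 2 n)
        ((Fin n → ZMod 2) × Option (Coins n (K * Nat.clog 2 n))),
      ImplementsHMST M mst (3 * ((Nat.clog 2 n + 1) * K)) := by
  set R := (Nat.clog 2 n + 1) * K with hR
  let z : Fin n := ⟨0, hn⟩
  have hrun := fun x t i => hmst_run (K := K) z rfl x t i
  let decodeProj (log : ℕ → Fin n → Fin (Nat.clog 2 n) → Bool) (i : Fin n)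
      (s : Fin (Nat.clog 2 n + 1)) (a : Fin (K * Nat.clog 2 n)) : ZMod 2 :=
    if tableOfMessages (fun u => log (2 * R + u) i) s a then 1 else 0
  have hproj : ∀ (x : Points n × Coins n (K * Nat.clog 2 n)) (i : Fin n),
      decodeProj (fun v => if v < 3 * R then hmstLog z x i v else fun _ _ => false) =
        projection x.1 x.2 := by
    intro x i
    funext j s a
    simp only [decodeProj]
    rw [tableOfMessages_eq (projectionBits (x.1 j) x.2)]
    · have h01 : ∀ y : ZMod 2, (if decide (y = 1) then (1 : ZMod 2) else 0) = y := by decide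
      exact h01 _
    · intro u hu
      rw [if_pos (by omega)]
      simp only [hmstLog]
      rw [if_neg (by omega), if_neg (by omega)]
      congr 1
      omega
  refine ⟨recordingAlgorithm fun _ d u log i => hmstMessage (K := K) z d u log i,
    2 * R, 3 * R, by omega, le_rfl, fun i => ?_, fun i _ => ?_, fun i _ => ?_⟩
  · refine ⟨fun σ => projMatrix (coinsOfMessages fun v => σ.2.2 (R + v)), fun x => ?_⟩
    rw [hrun]
    simp only
    rw [coinsOfMessages_eq x.2]
    intro j u hu
    rw [if_pos (by omega)]
    simp only [hmstLog]
    rw [if_neg (by omega), if_pos (by omega)]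
    congr 1
    omega
  · refine ⟨fun σ => decodeProj σ.2.2, fun x => ?_⟩
    rw [hrun]
    exact hproj x i
  · refine ⟨fun σ => mst fun i j => sInf (insert (2 ^ Nat.clog 2 n)
      {r : ℕ | ∃ s : Fin (Nat.clog 2 n + 1), r = 2 ^ (s : ℕ) ∧
        4 * hammingDist (decodeProj σ.2.2 i s) (decodeProj σ.2.2 j s) ≤ K * Nat.clog 2 n}),
      fun x => ?_⟩
    rw [hrun]
    simp only
    rw [hproj x i]
    rfl

end Protocol

/-! ### Numerical bounds and conclusion -/

lemma one_le_logb_two {n : ℕ} (hn : 2 ≤ n) : 1 ≤ Real.logb 2 n := by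
  rw [Real.le_logb_iff_rpow_le (by norm_num) (by positivity)]
  simpa using (by exact_mod_cast hn : (2 : ℝ) ≤ n)

lemma clog_add_one_le_three_mul_logb {n : ℕ} (hn : 2 ≤ n) :
    (Nat.clog 2 n : ℝ) + 1 ≤ 3 * Real.logb 2 n := by
  have hlog := one_le_logb_two hn
  have h := Nat.ceil_lt_add_one (zero_le_one.trans hlog)
  rw [← Nat.cast_ofNat (R := ℝ) (n := 2), Real.natCeil_logb_natCast] at h
  push_cast at h
  linarith

/-- The total failure probability is at most `n ^ (-c)` when `K ≥ 3200 (4 + c)`. -/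
lemma union_bound_le {c : ℝ} {K n : ℕ} (hK : 3200 * (4 + c) ≤ K) (hn : 2 ≤ n) :
    (n : ℝ) ^ 2 * (Nat.clog 2 n + 1) *
      Real.exp (-((K * Nat.clog 2 n : ℕ) * (1 / 40) ^ 2 / 2)) ≤ (n : ℝ) ^ (-c) := by
  have hn0 : (0 : ℝ) < n := by positivity
  have hn2 : (2 : ℝ) ≤ n := by exact_mod_cast hn
  have hclog_le : Nat.clog 2 n ≤ n := by
    rw [Nat.clog_le_iff_le_pow (by norm_num)]
    exact Nat.lt_two_pow_self.le
  have hclog_le' : (Nat.clog 2 n : ℝ) ≤ n := by exact_mod_cast hclog_le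
  have hlog : Real.log n ≤ Nat.clog 2 n := by
    have h : Real.log n ≤ Real.log ((2 : ℝ) ^ Nat.clog 2 n) :=
      Real.log_le_log hn0 (by exact_mod_cast Nat.le_pow_clog (by norm_num) n)
    rw [Real.log_pow] at h
    have h2 : Real.log 2 ≤ 1 := by linarith [Real.log_two_lt_d9]
    nlinarith [Nat.cast_nonneg (α := ℝ) (Nat.clog 2 n)]
  have hlog0 : 0 ≤ Real.log n := Real.log_nonneg (by linarith)
  have hexp : Real.exp (-((K * Nat.clog 2 n : ℕ) * (1 / 40) ^ 2 / 2)) ≤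
      (n : ℝ) ^ (-(4 + c)) := by
    rw [Real.rpow_def_of_pos hn0, Real.exp_le_exp]
    push_cast
    have h1 := mul_le_mul_of_nonneg_right hK hlog0
    have h2 := mul_le_mul_of_nonneg_left hlog (Nat.cast_nonneg (α := ℝ) K)
    nlinarith
  calc (n : ℝ) ^ 2 * (Nat.clog 2 n + 1) * _ ≤ (n : ℝ) ^ 2 * n ^ 2 * (n : ℝ) ^ (-(4 + c)) := by
        gcongr
        nlinarith
    _ = (n : ℝ) ^ (-c) := by
      rw [← pow_add, ← Real.rpow_natCast, ← Real.rpow_add hn0]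
      congr 1
      push_cast
      ring

theorem theorem3p2 :
    ∃ δ : ℕ → unitInterval, ∀ c : ℝ, 0 < c → ∃ K₀ : ℕ, ∀ K : ℕ, K₀ ≤ K → ∃ C : ℝ,
      ∀ n : ℕ, 2 ≤ n →
      ∀ mst : (Fin n → Fin n → ℕ) → SimpleGraph (Fin n), IsMSTProcedure mst →
        -- round complexity, with messages of `⌈log₂ n⌉` bits and projections to `K ⌈log₂ n⌉` bits
        (∃ (M : CliqueAlgorithm n (Nat.clog 2 n)
              ((Fin n → ZMod 2) × Option (Coins n (K * Nat.clog 2 n)))) (t : ℕ),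
          ImplementsHMST M mst t ∧ (t : ℝ) ≤ C * Real.logb 2 n ^ 3) ∧
        -- the output is always a spanning tree
        (∀ (p : Points n) (ω : Coins n (K * Nat.clog 2 n)), (hmstTree mst p ω).IsTree) ∧
        -- approximation guarantee with high probability
        (∀ p : Points n,
          1 - (n : ℝ) ^ (-c) ≤ (coinMeasure δ n (K * Nat.clog 2 n)).real
            {ω | ∀ U : SimpleGraph (Fin n), IsMST (hamming p) U →
              treeCost (hamming p) (hmstTree mst p ω) ≤
                3 * treeCost (hamming p) U + (3 * n - 3)}) := by
  refine ⟨flipProb, fun c _ => ⟨⌈3200 * (4 + c)⌉₊, fun K hK => ⟨9 * K, fun n hn mst hmst =>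
    ⟨?_, fun p ω => (hmst _ (estimate_comm p ω)).1, fun p => ?_⟩⟩⟩⟩
  · obtain ⟨M, hM⟩ := exists_implementsHMST (by omega) K mst
    refine ⟨M, _, hM, ?_⟩
    have hlog := clog_add_one_le_three_mul_logb hn
    have h3 : Real.logb 2 n ≤ Real.logb 2 n ^ 3 := le_self_pow₀ (one_le_logb_two hn) (by norm_num)
    push_cast
    calc 3 * (((Nat.clog 2 n : ℝ) + 1) * K) ≤ 3 * ((3 * Real.logb 2 n ^ 3) * K) := by
          gcongr
          linarith
      _ = 9 * K * Real.logb 2 n ^ 3 := by ring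
  · calc 1 - (n : ℝ) ^ (-c) ≤ 1 - (n : ℝ) ^ 2 * (Nat.clog 2 n + 1) *
          Real.exp (-((K * Nat.clog 2 n : ℕ) * (1 / 40) ^ 2 / 2)) :=
          sub_le_sub_left (union_bound_le (Nat.ceil_le.1 hK) hn) 1
      _ ≤ _ := coinMeasure_wellSeparated_ge p
      _ ≤ _ := by
        refine MeasureTheory.measureReal_mono fun ω hω U hU => ?_
        exact treeCost_hmstTree_le hmst hω hU.1
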